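/- Let $E$ be a metric space with metric $\rho$ in which every closed ball is compact, and let $(X(t))_{t\ge 0}$ be a (conservative) standard Markov process with values in $E$, with laws $(\mathbb P^x)_{x\in E}$ and filtration $(\mathcal F_t)_{t\ge0}$: a strong Markov process with $\mathbb P^x(X(0)=x)=1$ which is c\`adl\`ag and quasi-left-continuous, the filtration being right-continuous and complete. Assume that $X$ is weakly Feller, i.e. for every $t\ge 0$ the operator $P_th(x)=\mathbb E^x\{h(X(t))\}$ maps the space of continuous functions $E\to\mathbb R$ vanishing at infinity into itself. Let $\mathcal O\subset E$ be open, let $\tau_{\mathcal O}=\inf\{t\ge 0: X(t)\notin\mathcal O\}$ (with $\inf\emptyset=\infty$), and assume (A1) for every $t>0$ the operator $P^{\tau_{\mathcal O}}_t h(x)=\mathbb E^x\{1_{\{t<\tau_{\mathcal O}\}}h(X(t))\}$ maps the space of continuous bounded functions $E\to\mathbb R$ into itself. Let $\alpha>0$, let $f,G,H:[0,\infty)\times E\to\mathbb R$ be continuous and bounded, and for $(s,x)\in[0,\infty)\times E$ put $$w(s,x)=\sup_\tau \mathbb E^x\Big\{\int_0^{\tau\wedge\tau_{\mathcal O}}e^{-\alpha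 u}f(s+u,X(u))\,du+1_{\{\tau<\tau_{\mathcal O}\}}e^{-\alpha\tau}G(s+\tau,X(\tau))+1_{\{\tau\ge\tau_{\mathcal O}\}}e^{-\alpha\tau_{\mathcal O}}H(s+\tau_{\mathcal O},X(\tau_{\mathcal O}))\Big\},$$ where the supremum is over all (possibly infinite) $(\mathcal F_t)$-stopping times $\tau$ and the last term is $0$ when $\tau_{\mathcal O}=\infty$. Assume $G\ge H$ on $[0,\infty)\times E$. Then for every $x\in\partial\mathcal O$ and every $s\ge 0$, $$\lim_{y\to x,\ y\in\mathcal O} w(s,y)=G(s,x),$$ and the convergence is uniform for $s$ and $x$ in compact sets: for all compact $S\subset[0,\infty)$ and $K\subset E$ and every $\varepsilon>0$ there is $\delta>0$ such that $|w(s,y)-G(s,x)|<\varepsilon$ whenever $s\in S$, $x\in K\cap\partial\mathcal O$, $y\in\mathcal O$ and $\rho(x,y)<\delta$. -/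

import Mathlib

open MeasureTheory Filter Topology Set
open scoped NNReal ENNReal BoundedContinuousFunction ZeroAtInfty

namespace BoundaryStopping

variable {E Ω : Type*}

/-- A (conservative) standard Markov process `(Ω, ℱ, X, (P x))` with values in `E`:
a normal, adapted, strong Markov process with right-continuous paths having left limits almost
surely, quasi-left-continuous, relative to a right-continuous and complete filtration. -/
structure IsStandardMarkovProcess [MetricSpace E] [MeasurableSpace E]
    [mΩ : MeasurableSpace Ω] (ℱ : Filtration ℝ≥0 mΩ) (X : ℝ≥0 → Ω → E)
    (P : E → Measure Ω) : Prop where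
  /-- Each `P x` is a probability measure. -/
  isProbability : ∀ x, IsProbabilityMeasure (P x)
  /-- The transition function is measurable in the starting point. -/
  measurable_transition : ∀ t : ℝ≥0, ∀ B : Set E, MeasurableSet B →
    Measurable fun x => P x (X t ⁻¹' B)
  /-- Under `P x` the process starts at `x`. -/
  start : ∀ x, ∀ᵐ ω ∂(P x), X 0 ω = x
  /-- The process is adapted. -/
  adapted : ∀ t : ℝ≥0, Measurable[ℱ t] (X t)
  /-- Paths are right-continuous. -/
  right_continuous : ∀ ω, ∀ t : ℝ≥0, ContinuousWithinAt (fun u => X u ω) (Ici t) t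
  /-- Paths have left limits in `E`. -/
  left_limits : ∀ x, ∀ᵐ ω ∂(P x), ∀ t : ℝ≥0, 0 < t →
    ∃ l : E, Tendsto (fun u => X u ω) (𝓝[<] t) (𝓝 l)
  /-- The filtration is right-continuous. -/
  filtration_right_continuous : ℱ.IsRightContinuous
  /-- The filtration is complete: `ℱ t` contains every set `A` that, for each initial law `μ`, lies
  between two sets of `ℱ t` whose difference is null for `P^μ = ∫ P x μ(dx)`. -/
  filtration_complete : ∀ t : ℝ≥0, ∀ A : Set Ω,
    (∀ μ : Measure E, IsProbabilityMeasure μ →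
      ∃ A₁ A₂ : Set Ω, MeasurableSet[ℱ t] A₁ ∧ MeasurableSet[ℱ t] A₂ ∧
        A₁ ⊆ A ∧ A ⊆ A₂ ∧ ∀ᵐ x ∂μ, P x (A₂ \ A₁) = 0) →
    MeasurableSet[ℱ t] A
  /-- Strong Markov property: for a stopping time `τ`, on `{τ < ∞}`,
  `P x (X (τ + t) ∈ B | ℱ_τ) = P (X τ) (X t ∈ B)`. -/
  strong_markov : ∀ τ : Ω → WithTop ℝ≥0, ∀ hτ : IsStoppingTime ℱ τ,
    ∀ (x : E) (t : ℝ≥0) (B : Set E) (A : Set Ω), MeasurableSet B →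
      MeasurableSet[hτ.measurableSpace] A →
      P x (A ∩ {ω | τ ω ≠ ⊤ ∧ X ((τ ω).untopA + t) ω ∈ B}) =
        ∫⁻ ω in A ∩ {ω | τ ω ≠ ⊤}, P (X (τ ω).untopA ω) (X t ⁻¹' B) ∂(P x)
  /-- Quasi-left-continuity: if stopping times `T n` increase to `T`, then `X (T n) → X T` almost
  surely on `{T < ∞}`. -/
  quasi_left_continuous : ∀ (T : ℕ → Ω → WithTop ℝ≥0) (T' : Ω → WithTop ℝ≥0),
    (∀ n, IsStoppingTime ℱ (T n)) → (∀ ω, Monotone fun n => T n ω) →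
    (∀ ω, IsLUB (range fun n => T n ω) (T' ω)) →
    ∀ x, ∀ᵐ ω ∂(P x), T' ω ≠ ⊤ →
      Tendsto (fun n => X (T n ω).untopA ω) atTop (𝓝 (X (T' ω).untopA ω))

/-- Weak Feller property: the transition semigroup `P_t h (x) = E^x [h (X t)]` maps the space of
continuous functions vanishing at infinity into itself. -/
def IsWeakFeller [TopologicalSpace E] [MeasurableSpace Ω] (X : ℝ≥0 → Ω → E)
    (P : E → Measure Ω) : Prop :=
  ∀ (t : ℝ≥0) (h : C₀(E, ℝ)), ∃ g : C₀(E, ℝ), ∀ x, g x = ∫ ω, h (X t ω) ∂(P x)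

/-- The first exit time `inf {t : X t ∉ O}` from `O`, equal to `⊤` if the path never leaves `O`. -/
noncomputable def exitTime (X : ℝ≥0 → Ω → E) (O : Set E) : Ω → WithTop ℝ≥0 :=
  hittingAfter X Oᶜ 0

/-- For every `t > 0` the operator `h ↦ (x ↦ E^x [1_{t < τ_O} h (X t)])` of the stopped semigroup
maps bounded continuous functions to (bounded) continuous functions. -/
def StoppedFeller [TopologicalSpace E] [MeasurableSpace Ω] (X : ℝ≥0 → Ω → E)
    (P : E → Measure Ω) (O : Set E) : Prop :=
  ∀ t : ℝ≥0, 0 < t → ∀ h : E →ᵇ ℝ,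
    Continuous fun x => ∫ ω, {ω | (t : WithTop ℝ≥0) < exitTime X O ω}.indicator
      (fun ω => h (X t ω)) ω ∂(P x)

/-- The discounted payoff `e^{-α σ} φ (s + σ, X σ)` along the path `ω`; it is `0` for `σ = ∞`. -/
noncomputable def discountedPayoff (X : ℝ≥0 → Ω → E) (α : ℝ) (φ : ℝ≥0 × E → ℝ) (s : ℝ≥0)
    (ω : Ω) : WithTop ℝ≥0 → ℝ
  | ⊤ => 0
  | (σ : ℝ≥0) => Real.exp (-(α * (σ : ℝ))) * φ (s + σ, X σ ω)

/-- The running payoff `∫_0^σ e^{-α u} f (s + u, X u) du` along the path `ω`. -/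
noncomputable def runningPayoff (X : ℝ≥0 → Ω → E) (α : ℝ) (f : ℝ≥0 × E → ℝ) (s : ℝ≥0)
    (ω : Ω) (σ : WithTop ℝ≥0) : ℝ :=
  ∫ u in {u : ℝ | 0 ≤ u ∧ (u.toNNReal : WithTop ℝ≥0) < σ},
    Real.exp (-(α * u)) * f (s + u.toNNReal, X u.toNNReal ω)

open Classical in
/-- The functional
`J(s,x,τ) = E^x [∫_0^{τ ∧ τ_O} e^{-α u} f(s+u, X u) du + 1_{τ < τ_O} e^{-α τ} G(s+τ, X τ)
  + 1_{τ ≥ τ_O} e^{-α τ_O} H(s+τ_O, X τ_O)]`. -/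
noncomputable def functional [MeasurableSpace Ω] (X : ℝ≥0 → Ω → E) (P : E → Measure Ω)
    (O : Set E) (α : ℝ) (f G H : ℝ≥0 × E → ℝ) (s : ℝ≥0) (x : E) (τ : Ω → WithTop ℝ≥0) : ℝ :=
  ∫ ω, (runningPayoff X α f s ω (min (τ ω) (exitTime X O ω)) +
    if τ ω < exitTime X O ω then discountedPayoff X α G s ω (τ ω)
    else discountedPayoff X α H s ω (exitTime X O ω)) ∂(P x)

/-- The value function `w(s,x) = sup_τ J(s,x,τ)`, the supremum being over all (possibly infinite)
stopping times of the filtration. -/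
noncomputable def valueFunction [mΩ : MeasurableSpace Ω] (ℱ : Filtration ℝ≥0 mΩ)
    (X : ℝ≥0 → Ω → E) (P : E → Measure Ω) (O : Set E) (α : ℝ) (f G H : ℝ≥0 × E → ℝ)
    (s : ℝ≥0) (x : E) : ℝ :=
  ⨆ τ : {τ : Ω → WithTop ℝ≥0 // IsStoppingTime ℱ τ}, functional X P O α f G H s x τ.1

end BoundaryStopping

/-! The lower bound is immediate: from `y ∈ O`, stopping at once pays `G (s, y)`, and `G` is
continuous. For the upper bound, a process started in `O` near a boundary point `x` leaves `O`
within a short time `t` with probability close to one, while hardly moving. Up to exit the running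
payoff is at most `‖f‖ * t`, discounting changes a payoff by at most `‖G‖ * (α * t)`, and the
terminal payoff is `G`, or `H ≤ G`, taken near `(s, x)`. Hence no stopping time gains much over `G
(s, x)`.

Two estimates carry this. Fast exit (`tendsto_measureReal_lt_exitTime`): (A1) for the constant `1`
makes the survival probability up to `t` continuous in the starting point, and it vanishes at `x`
because `x ∉ O`. Small displacement (`eventually_measureReal_exists_dist_gt_le`): a maximal
inequality, uniform over starting points in a ball, which follows from the Markov property at a
first visit and from strong continuity of the semigroup on `C₀` (`tendstoUniformly_integral_comp`).

Both estimates are locally uniform, so the limit is joint in `(s, y)`; compactness then gives the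
uniform statement. -/

namespace BoundaryStopping

variable {E Ω : Type*}

/-! ### Joint measurability of the process -/

section Measurability

variable [MetricSpace E] [MeasurableSpace E] [mΩ : MeasurableSpace Ω]
  {ℱ : Filtration ℝ≥0 mΩ} {X : ℝ≥0 → Ω → E} {P : E → Measure Ω}

lemma IsStandardMarkovProcess.measurable (hX : IsStandardMarkovProcess ℱ X P) (t : ℝ≥0) :
    Measurable (X t) :=
  (hX.adapted t).mono (ℱ.le t) le_rfl

/-- Times can be approximated from the right by measurable functions with countable range. -/
lemma exists_right_approximation : ∃ (e : ℕ → ℕ → ℝ≥0) (k : ℕ → ℝ≥0 → ℕ),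
    (∀ n, Measurable (k n)) ∧ (∀ n t, t ≤ e n (k n t)) ∧
      ∀ t, Tendsto (fun n => e n (k n t)) atTop (𝓝 t) := by
  have hpos : ∀ n : ℕ, (0 : ℝ≥0) < (n : ℝ≥0) + 1 := fun n => by positivity
  have hge : ∀ (n : ℕ) (t : ℝ≥0),
      t ≤ ((⌊((n : ℝ≥0) + 1) * t⌋₊ : ℝ≥0) + 1) / ((n : ℝ≥0) + 1) := fun n t => by
    rw [le_div_iff₀ (hpos n), mul_comm]
    exact (Nat.lt_floor_add_one _).le
  -- The `+ 1` in the numerator puts the grid point to the right of `t`, where paths are continuous.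
  refine ⟨fun n k => ((k : ℝ≥0) + 1) / ((n : ℝ≥0) + 1), fun n t => ⌊((n : ℝ≥0) + 1) * t⌋₊,
    fun n => Nat.measurable_floor.comp (measurable_const.mul measurable_id), hge, fun t => ?_⟩
  refine tendsto_of_tendsto_of_tendsto_of_le_of_le (h := fun n : ℕ => t + 1 / ((n : ℝ≥0) + 1))
    tendsto_const_nhds ?_ (fun n => hge n t) (fun n => ?_)
  · simpa using tendsto_const_nhds.add
      (tendsto_one_div_add_atTop_nhds_zero_nat (𝕜 := ℝ≥0))
  · have : t + 1 / ((n : ℝ≥0) + 1) = (((n : ℝ≥0) + 1) * t + 1) / ((n : ℝ≥0) + 1) := by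
      rw [add_div, mul_div_cancel_left₀ _ (hpos n).ne']
    beta_reduce
    rw [this]
    gcongr
    exact Nat.floor_le zero_le

/-- A measurable right-continuous process is jointly measurable. -/
lemma measurable_uncurry_of_right_continuous {α β : Type*} [MeasurableSpace α]
    [TopologicalSpace β] [TopologicalSpace.PseudoMetrizableSpace β] [MeasurableSpace β]
    [BorelSpace β] {Y : ℝ≥0 → α → β} (hY : ∀ t, Measurable (Y t))
    (hc : ∀ ω, ∀ t : ℝ≥0, ContinuousWithinAt (fun u => Y u ω) (Ici t) t) :
    Measurable fun p : ℝ≥0 × α => Y p.1 p.2 := by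
  obtain ⟨e, k, hk, hge, hlim⟩ := exists_right_approximation
  refine measurable_of_tendsto_metrizable
    (f := fun n (p : ℝ≥0 × α) => Y (e n (k n p.1)) p.2) (fun n => ?_) ?_
  · have h1 : Measurable fun q : ℕ × α => Y (e n q.1) q.2 :=
      measurable_from_prod_countable_right fun i => hY (e n i)
    exact h1.comp (((hk n).comp measurable_fst).prodMk measurable_snd)
  · rw [tendsto_pi_nhds]
    rintro ⟨t, ω⟩
    exact (hc ω t).tendsto.comp
      (tendsto_nhdsWithin_iff.2 ⟨hlim t, Eventually.of_forall fun n => hge n t⟩)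

lemma IsStandardMarkovProcess.measurable_uncurry [BorelSpace E]
    (hX : IsStandardMarkovProcess ℱ X P) :
    Measurable fun p : ℝ≥0 × Ω => X p.1 p.2 :=
  measurable_uncurry_of_right_continuous hX.measurable hX.right_continuous

end Measurability

/-! ### The transition semigroup and the simple Markov property -/

section Semigroup

variable [MetricSpace E] [MeasurableSpace E] [BorelSpace E] [mΩ : MeasurableSpace Ω]
  {ℱ : Filtration ℝ≥0 mΩ} {X : ℝ≥0 → Ω → E} {P : E → Measure Ω}

omit [BorelSpace E] in
lemma IsStandardMarkovProcess.measure_inter_add (hX : IsStandardMarkovProcess ℱ X P)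
    (x : E) (s t : ℝ≥0) {B : Set E} (hB : MeasurableSet B) {A : Set Ω}
    (hA : MeasurableSet[ℱ t] A) :
    P x (A ∩ X (t + s) ⁻¹' B) = ∫⁻ ω in A, P (X t ω) (X s ⁻¹' B) ∂(P x) := by
  have h := hX.strong_markov (fun _ => (t : WithTop ℝ≥0)) (isStoppingTime_const ℱ t) x s B A hB
    (by rw [IsStoppingTime.measurableSpace_const]; exact hA)
  have e : {ω | (t : WithTop ℝ≥0) ≠ ⊤ ∧ X ((t : WithTop ℝ≥0).untopA + s) ω ∈ B} =
      X (t + s) ⁻¹' B := by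
    ext ω
    exact and_iff_right WithTop.coe_ne_top
  have e' : {ω : Ω | (t : WithTop ℝ≥0) ≠ ⊤} = univ :=
    eq_univ_of_forall fun ω => WithTop.coe_ne_top
  rw [e, e', inter_univ] at h
  exact h

/-- The Markov property at a fixed time, integrated over an event of the past. -/
lemma IsStandardMarkovProcess.setIntegral_add (hX : IsStandardMarkovProcess ℱ X P)
    (x : E) (s t : ℝ≥0) {A : Set Ω} (hA : MeasurableSet[ℱ t] A) (h : E →ᵇ ℝ) :
    ∫ ω in A, h (X (t + s) ω) ∂(P x) = ∫ ω in A, (∫ ω', h (X s ω') ∂(P (X t ω))) ∂(P x) := by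
  have := hX.isProbability
  let κ : ProbabilityTheory.Kernel E E :=
    { toFun := fun z => (P z).map (X s)
      measurable' := by
        refine Measure.measurable_of_measurable_coe _ fun B hB => ?_
        simp_rw [Measure.map_apply (hX.measurable s) hB]
        exact hX.measurable_transition s B hB }
  have hκ : ∀ z, κ z = (P z).map (X s) := fun z => rfl
  let ν : Measure E := ((P x).restrict A).map (X t)
  have hA' : MeasurableSet A := ℱ.le t _ hA
  -- Chapman–Kolmogorov for the measure restricted to `A`: both sides of the claim are integrals of
  -- `h` against this one measure.
  have hbind : ν.bind κ = ((P x).restrict A).map (X (t + s)) := by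
    ext B hB
    rw [Measure.bind_apply hB κ.measurable.aemeasurable,
      lintegral_map (κ.measurable_coe hB) (hX.measurable t),
      Measure.map_apply (hX.measurable _) hB,
      Measure.restrict_apply (hX.measurable _ hB), Set.inter_comm,
      hX.measure_inter_add x s t hB hA]
    simp_rw [hκ, Measure.map_apply (hX.measurable s) hB]
  have hfin : IsProbabilityMeasure ((P x).map (X t)) :=
    Measure.isProbabilityMeasure_map (hX.measurable t).aemeasurable
  have hh : AEStronglyMeasurable h (ν.bind κ) :=
    h.continuous.measurable.aestronglyMeasurable
  have hmeas : Measurable (h : E → ℝ) := h.continuous.measurable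
  have hint : Integrable h (ν.bind κ) := by
    rw [hbind]
    exact Integrable.of_bound h.continuous.measurable.aestronglyMeasurable ‖h‖
      (Eventually.of_forall h.norm_coe_le_norm)
  calc ∫ ω in A, h (X (t + s) ω) ∂(P x) = ∫ z, h z ∂(ν.bind κ) := by
        rw [hbind, integral_map (hX.measurable _).aemeasurable hmeas.aestronglyMeasurable]
    _ = ∫ z, ∫ y, h y ∂κ z ∂ν := by
        rw [Measure.comp_eq_comp_const_apply] at hint ⊢
        rw [ProbabilityTheory.Kernel.integral_comp hint]
        simp
    _ = ∫ ω in A, ∫ y, h y ∂κ (X t ω) ∂(P x) := by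
        refine integral_map (hX.measurable t).aemeasurable ?_
        exact (StronglyMeasurable.integral_kernel hmeas.stronglyMeasurable).aestronglyMeasurable
    _ = _ := by
        simp_rw [hκ, integral_map (hX.measurable s).aemeasurable hmeas.aestronglyMeasurable]

lemma IsStandardMarkovProcess.integrable_comp (hX : IsStandardMarkovProcess ℱ X P)
    (x : E) (t : ℝ≥0) (h : E →ᵇ ℝ) : Integrable (fun ω => h (X t ω)) (P x) := by
  have := hX.isProbability
  exact Integrable.of_bound (h.continuous.measurable.comp (hX.measurable t)).aestronglyMeasurable
    ‖h‖ (Eventually.of_forall fun ω => h.norm_coe_le_norm _)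

omit [BorelSpace E] in
lemma IsStandardMarkovProcess.abs_integral_comp_le (hX : IsStandardMarkovProcess ℱ X P)
    (x : E) (t : ℝ≥0) (h : E →ᵇ ℝ) : |∫ ω, h (X t ω) ∂(P x)| ≤ ‖h‖ := by
  have := hX.isProbability
  simpa using norm_integral_le_of_norm_le_const (μ := P x) (f := fun ω => h (X t ω))
    (Eventually.of_forall fun ω => h.norm_coe_le_norm _)

lemma IsStandardMarkovProcess.measurable_integral_comp (hX : IsStandardMarkovProcess ℱ X P)
    (x : E) (h : E →ᵇ ℝ) : Measurable fun t : ℝ≥0 => ∫ ω, h (X t ω) ∂(P x) := by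
  have := hX.isProbability
  have h1 : StronglyMeasurable fun p : ℝ≥0 × Ω => h (X p.1 p.2) :=
    (h.continuous.measurable.comp hX.measurable_uncurry).stronglyMeasurable
  exact h1.integral_prod_right'.measurable

lemma IsStandardMarkovProcess.continuousWithinAt_integral_comp
    (hX : IsStandardMarkovProcess ℱ X P) (x : E) (h : E →ᵇ ℝ) (t : ℝ≥0) :
    ContinuousWithinAt (fun t : ℝ≥0 => ∫ ω, h (X t ω) ∂(P x)) (Ici t) t := by
  have := hX.isProbability
  exact tendsto_integral_filter_of_dominated_convergence (fun _ => ‖h‖)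
    (Eventually.of_forall fun t => (hX.integrable_comp x t h).aestronglyMeasurable)
    (Eventually.of_forall fun t => Eventually.of_forall fun ω => h.norm_coe_le_norm _)
    (integrable_const _) (Eventually.of_forall fun ω =>
      (h.continuous.tendsto _).comp (hX.right_continuous ω t).tendsto)

lemma IsStandardMarkovProcess.tendsto_integral_comp_zero (hX : IsStandardMarkovProcess ℱ X P)
    (x : E) (h : E →ᵇ ℝ) :
    Tendsto (fun t : ℝ≥0 => ∫ ω, h (X t ω) ∂(P x)) (𝓝 0) (𝓝 (h x)) := by
  have := hX.isProbability
  have hx : ∫ ω, h (X 0 ω) ∂(P x) = h x := by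
    rw [integral_congr_ae ((hX.start x).mono fun ω hω => congrArg h hω)]
    simp
  have h0 := (hX.continuousWithinAt_integral_comp x h 0).tendsto
  have huniv : Ici (0 : ℝ≥0) = univ := by ext; simp
  rwa [huniv, nhdsWithin_univ, hx] at h0

end Semigroup

/-! ### Strong continuity of the semigroup on `C₀` -/

section StrongContinuity

variable [MetricSpace E] [ProperSpace E] [MeasurableSpace E] [BorelSpace E]
  [mΩ : MeasurableSpace Ω]
  {ℱ : Filtration ℝ≥0 mΩ} {X : ℝ≥0 → Ω → E} {P : E → Measure Ω}

/-- Dominated convergence along `cocompact E`, used to show that time averages vanish at infinity,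
needs a countably generated filter. -/
instance isCountablyGenerated_cocompact : (cocompact E).IsCountablyGenerated := by
  rcases isEmpty_or_nonempty E with hE | ⟨⟨c⟩⟩
  · rw [filter_eq_bot_of_isEmpty (cocompact E)]
    infer_instance
  · rw [← Metric.cobounded_eq_cocompact, ← Metric.comap_dist_left_atTop c]
    infer_instance

/-- Time averages of the transition semigroup preserve `C₀`. -/
lemma exists_average (hX : IsStandardMarkovProcess ℱ X P) (hF : IsWeakFeller X P)
    (h : C₀(E, ℝ)) (a : ℝ) :
    ∃ g : C₀(E, ℝ), ∀ x, g x = a⁻¹ * ∫ s in (0 : ℝ)..a, ∫ ω, h (X s.toNNReal ω) ∂(P x) := by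
  have hmeas : ∀ x, Measurable fun s : ℝ => ∫ ω, h (X s.toNNReal ω) ∂(P x) := fun x =>
    (hX.measurable_integral_comp x h.toBCF).comp measurable_real_toNNReal
  have hbound : ∀ x (s : ℝ), ‖∫ ω, h (X s.toNNReal ω) ∂(P x)‖ ≤ ‖h.toBCF‖ := fun x s =>
    hX.abs_integral_comp_le x s.toNNReal h.toBCF
  refine ⟨⟨⟨fun x => a⁻¹ * ∫ s in (0 : ℝ)..a, ∫ ω, h (X s.toNNReal ω) ∂(P x), ?_⟩, ?_⟩,
    fun x => rfl⟩
  · refine continuous_const.mul (intervalIntegral.continuous_of_dominated_interval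
      (bound := fun _ => ‖h.toBCF‖) (fun x => (hmeas x).aestronglyMeasurable)
      (fun x => Eventually.of_forall fun s _ => hbound x s) (by simp)
      (Eventually.of_forall fun s _ => ?_))
    obtain ⟨g, hg⟩ := hF s.toNNReal h
    simp_rw [← hg]
    exact g.continuous
  · have h0 : Tendsto (fun x => ∫ s in (0 : ℝ)..a, ∫ ω, h (X s.toNNReal ω) ∂(P x)) (cocompact E)
        (𝓝 (∫ s in (0 : ℝ)..a, (0 : ℝ))) := by
      refine intervalIntegral.tendsto_integral_filter_of_dominated_convergence
        (fun _ => ‖h.toBCF‖)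
        (Eventually.of_forall fun x => (hmeas x).aestronglyMeasurable)
        (Eventually.of_forall fun x => Eventually.of_forall fun s _ => hbound x s) (by simp)
        (Eventually.of_forall fun s _ => ?_)
      obtain ⟨g, hg⟩ := hF s.toNNReal h
      simp_rw [← hg]
      exact g.zero_at_infty'
    simpa using h0.const_mul a⁻¹

omit [ProperSpace E] in
/-- Time averages are Lipschitz along the semigroup. -/
lemma abs_integral_average_sub_le (hX : IsStandardMarkovProcess ℱ X P) (hF : IsWeakFeller X P)
    (h g : C₀(E, ℝ)) {a : ℝ} (ha : 0 < a)
    (hg : ∀ x, g x = a⁻¹ * ∫ s in (0 : ℝ)..a, ∫ ω, h (X s.toNNReal ω) ∂(P x))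
    (t : ℝ≥0) (y : E) :
    |∫ ω, g (X t ω) ∂(P y) - g y| ≤ 2 * ‖h.toBCF‖ / a * t := by
  have := hX.isProbability
  let φ : ℝ → ℝ := fun s => ∫ ω, h (X s.toNNReal ω) ∂(P y)
  have hφm : Measurable φ :=
    (hX.measurable_integral_comp y h.toBCF).comp measurable_real_toNNReal
  have hφb : ∀ s, ‖φ s‖ ≤ ‖h.toBCF‖ := fun s => hX.abs_integral_comp_le y s.toNNReal h.toBCF
  have hφi : ∀ b c, IntervalIntegrable φ volume b c := fun b c =>
    (intervalIntegrable_const (c := ‖h.toBCF‖)).mono_fun hφm.aestronglyMeasurable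
      (Eventually.of_forall fun s => by simpa using hφb s)
  -- Fubini below needs joint measurability in time and starting point; the lemma on
  -- right-continuous processes supplies it with `E` in the role of the sample space.
  have hjoint : Measurable fun p : ℝ≥0 × E => ∫ ω, h (X p.1 ω) ∂(P p.2) := by
    refine measurable_uncurry_of_right_continuous
      (Y := fun s x => ∫ ω, h (X s ω) ∂(P x)) (fun s => ?_)
      fun x s => hX.continuousWithinAt_integral_comp x h.toBCF s
    obtain ⟨g, hg⟩ := hF s h
    simp_rw [← hg]
    exact g.continuous.measurable
  have hshift : ∫ ω, g (X t ω) ∂(P y) = a⁻¹ * ∫ s in (t : ℝ)..t + a, φ s := by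
    simp_rw [hg]
    rw [integral_const_mul]
    congr 1
    simp_rw [intervalIntegral.integral_of_le ha.le]
    rw [integral_integral_swap]
    · rw [← intervalIntegral.integral_of_le ha.le]
      have h2 : ∫ s in (t : ℝ)..t + a, φ s = ∫ s in (0 : ℝ)..a, φ (t + s) := by
        rw [intervalIntegral.integral_comp_add_left]; simp
      rw [h2]
      refine intervalIntegral.integral_congr fun s hs => ?_
      rw [uIcc_of_le ha.le] at hs
      have h3 := hX.setIntegral_add y s.toNNReal t (A := univ) MeasurableSet.univ h.toBCF
      simp only [Measure.restrict_univ] at h3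
      simp only [φ]
      have h8 : ((t : ℝ) + s).toNNReal = t + s.toNNReal := by
        rw [Real.toNNReal_add t.coe_nonneg hs.1, Real.toNNReal_coe]
      rw [h8]
      exact h3.symm
    · have := Measure.prod.instIsFiniteMeasure (P y) (volume.restrict (Ioc 0 a))
      refine Integrable.of_bound (C := ‖h.toBCF‖) ?_ (Eventually.of_forall fun p =>
        hX.abs_integral_comp_le _ _ h.toBCF)
      exact (hjoint.comp ((measurable_real_toNNReal.comp measurable_snd).prodMk
        ((hX.measurable t).comp measurable_fst))).aestronglyMeasurable
  rw [hshift, hg y, ← mul_sub]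
  -- Shifting the window `[0, a]` by `t` changes the integral only by two pieces of length `t`,
  -- whence the bound uniform in `y`.
  have h4 : ∫ s in (t : ℝ)..t + a, φ s = (∫ s in (0 : ℝ)..a, φ s) + (∫ s in a..t + a, φ s)
      - ∫ s in (0 : ℝ)..t, φ s := by
    have e1 := intervalIntegral.integral_add_adjacent_intervals (hφi 0 t) (hφi t (t + a))
    have e2 := intervalIntegral.integral_add_adjacent_intervals (hφi 0 a) (hφi a (t + a))
    linarith
  have h5 : |∫ s in a..t + a, φ s| ≤ ‖h.toBCF‖ * t := by
    have := intervalIntegral.norm_integral_le_of_norm_le_const (a := a) (b := t + a) (f := φ)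
      (C := ‖h.toBCF‖) (fun s _ => hφb s)
    simpa using this
  have h6 : |∫ s in (0 : ℝ)..t, φ s| ≤ ‖h.toBCF‖ * t := by
    have := intervalIntegral.norm_integral_le_of_norm_le_const (a := 0) (b := t) (f := φ)
      (C := ‖h.toBCF‖) (fun s _ => hφb s)
    simpa using this
  have h7 : (∫ s in (t : ℝ)..t + a, φ s) - (∫ s in (0 : ℝ)..a, φ s)
      = (∫ s in a..t + a, φ s) - ∫ s in (0 : ℝ)..t, φ s := by rw [h4]; ring
  rw [h7, abs_mul, abs_of_pos (inv_pos.2 ha)]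
  calc a⁻¹ * |(∫ s in a..t + a, φ s) - ∫ s in (0 : ℝ)..t, φ s|
      ≤ a⁻¹ * (‖h.toBCF‖ * t + ‖h.toBCF‖ * t) := by
        gcongr
        exact (abs_sub _ _).trans (add_le_add h5 h6)
    _ = _ := by field_simp; ring

/-- The continuous extension by zero of a function in `C₀` to the one-point compactification. -/
noncomputable def onePointExtension (h : C₀(E, ℝ)) : C(OnePoint E, ℝ) :=
  OnePoint.continuousMapMk h.toContinuousMap 0
    (by rw [coclosedCompact_eq_cocompact]; exact h.zero_at_infty')

omit [ProperSpace E] [MeasurableSpace E] [BorelSpace E] in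
lemma abs_onePointExtension_le (h : C₀(E, ℝ)) {C : ℝ} (hC : 0 ≤ C) (hh : ∀ x, |h x| ≤ C)
    (z : OnePoint E) : |onePointExtension h z| ≤ C := by
  induction z using OnePoint.rec with
  | infty => simpa [onePointExtension, OnePoint.continuousMapMk] using hC
  | coe x => exact hh x

/-- A weakly Feller right-continuous semigroup is strongly continuous on `C₀`. -/
lemma tendstoUniformly_integral_comp (hX : IsStandardMarkovProcess ℱ X P)
    (hF : IsWeakFeller X P) (h : C₀(E, ℝ)) :
    TendstoUniformly (fun (t : ℝ≥0) x => ∫ ω, h (X t ω) ∂(P x) - h x) (fun _ => 0) (𝓝 0) := by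
  have := hX.isProbability
  -- Uniform convergence is tested along ultrafilters in time and starting point. On the compact
  -- one-point compactification both the laws of `X t` and the starting points converge, to `μ` and
  -- `z`. It remains to show that `μ` integrates the extension of `h` to its value at `z`. Time
  -- averages satisfy this by their Lipschitz bound, and they converge to `h` pointwise and
  -- boundedly, which suffices for integrals against the single measure `μ`.
  rw [← tendsto_prod_top_iff, tendsto_iff_ultrafilter]
  intro U hU
  let _ : MeasurableSpace (OnePoint E) := borel _
  have : BorelSpace (OnePoint E) := ⟨rfl⟩
  have hcoe : Measurable ((↑) : E → OnePoint E) := OnePoint.continuous_coe.measurable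
  let ν : ℝ≥0 × E → ProbabilityMeasure (OnePoint E) := fun p =>
    ⟨(P p.2).map fun ω => (X p.1 ω : OnePoint E),
      Measure.isProbabilityMeasure_map (hcoe.comp (hX.measurable p.1)).aemeasurable⟩
  let μ : ProbabilityMeasure (OnePoint E) := (U.map ν).lim
  let z : OnePoint E := (U.map fun p => (p.2 : OnePoint E)).lim
  have hμ : Tendsto ν U (𝓝 μ) := (U.map ν).le_nhds_lim
  have hz : Tendsto (fun p : ℝ≥0 × E => (p.2 : OnePoint E)) U (𝓝 z) :=
    (U.map fun p : ℝ≥0 × E => (p.2 : OnePoint E)).le_nhds_lim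
  have hint : ∀ g : C₀(E, ℝ), Tendsto (fun p : ℝ≥0 × E => ∫ ω, g (X p.1 ω) ∂(P p.2) - g p.2) U
      (𝓝 (∫ w, onePointExtension g w ∂(μ : Measure (OnePoint E)) - onePointExtension g z)) := by
    intro g
    have h1 := (ProbabilityMeasure.tendsto_iff_forall_integral_tendsto.1 hμ)
      (BoundedContinuousFunction.mkOfCompact (onePointExtension g))
    have h2 := ((onePointExtension g).continuous.tendsto z).comp hz
    refine (h1.sub h2).congr fun p => ?_
    congr 1
    exact integral_map (hcoe.comp (hX.measurable p.1)).aemeasurable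
      (onePointExtension g).continuous.measurable.aestronglyMeasurable
  suffices hzero : ∫ w, onePointExtension h w ∂(μ : Measure (OnePoint E))
      - onePointExtension h z = 0 by
    have := hint h
    rwa [hzero] at this
  choose g hg using fun n : ℕ => exists_average hX hF h (1 / ((n : ℝ) + 1))
  have hpos : ∀ n : ℕ, 0 < 1 / ((n : ℝ) + 1) := fun n => by positivity
  have hU1 : Tendsto (fun p : ℝ≥0 × E => p.1) U (𝓝 0) := tendsto_fst.mono_left hU
  have hgz : ∀ n, ∫ w, onePointExtension (g n) w ∂(μ : Measure (OnePoint E))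
      = onePointExtension (g n) z := fun n => by
    have h0 : Tendsto (fun p : ℝ≥0 × E => ∫ ω, g n (X p.1 ω) ∂(P p.2) - g n p.2) U (𝓝 0) := by
      refine squeeze_zero_norm (fun p => abs_integral_average_sub_le hX hF h (g n) (hpos n)
        (hg n) p.1 p.2) ?_
      have := ((NNReal.continuous_coe.tendsto 0).comp hU1).const_mul
        (2 * ‖h.toBCF‖ / (1 / ((n : ℝ) + 1)))
      simpa using this
    exact sub_eq_zero.1 (tendsto_nhds_unique (hint (g n)) h0)
  have hgb : ∀ n x, |g n x| ≤ ‖h.toBCF‖ := fun n x => by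
    have h1 := intervalIntegral.norm_integral_le_of_norm_le_const (a := 0)
      (b := 1 / ((n : ℝ) + 1)) (f := fun s => ∫ ω, h (X s.toNNReal ω) ∂(P x))
      (C := ‖h.toBCF‖) (fun s _ => hX.abs_integral_comp_le x s.toNNReal h.toBCF)
    rw [hg n x, abs_mul, abs_of_pos (inv_pos.2 (hpos n)), inv_mul_le_iff₀ (hpos n), mul_comm]
    rwa [sub_zero, abs_of_pos (hpos n)] at h1
  have hglim : ∀ x, Tendsto (fun n => g n x) atTop (𝓝 (h x)) := fun x => by
    rw [Metric.tendsto_nhds]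
    intro ε hε
    have h1 : ∀ᶠ t : ℝ≥0 in 𝓝 0, dist (∫ ω, h (X t ω) ∂(P x)) (h x) < ε / 2 :=
      Metric.tendsto_nhds.1 (hX.tendsto_integral_comp_zero x h.toBCF) _ (half_pos hε)
    obtain ⟨δ, hδ, hδ'⟩ := Metric.eventually_nhds_iff.1 h1
    have h2 : ∀ᶠ n : ℕ in atTop, 1 / ((n : ℝ) + 1) < δ :=
      tendsto_one_div_add_atTop_nhds_zero_nat.eventually_lt_const hδ
    filter_upwards [h2] with n hn
    have h3 : ∫ s in (0 : ℝ)..1 / ((n : ℝ) + 1), (∫ ω, h (X s.toNNReal ω) ∂(P x) - h x)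
        = (∫ s in (0 : ℝ)..1 / ((n : ℝ) + 1), ∫ ω, h (X s.toNNReal ω) ∂(P x))
          - 1 / ((n : ℝ) + 1) * h x := by
      rw [intervalIntegral.integral_sub _ (by simp)]
      · simp
      · exact (intervalIntegrable_const (c := ‖h.toBCF‖)).mono_fun
          ((hX.measurable_integral_comp x h.toBCF).comp
            measurable_real_toNNReal).aestronglyMeasurable
          (Eventually.of_forall fun s => by
            simpa using hX.abs_integral_comp_le x s.toNNReal h.toBCF)
    have h4 := intervalIntegral.norm_integral_le_of_norm_le_const (a := 0)
      (b := 1 / ((n : ℝ) + 1)) (f := fun s => ∫ ω, h (X s.toNNReal ω) ∂(P x) - h x)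
      (C := ε / 2) (fun s hs => by
        rw [uIoc_of_le (hpos n).le] at hs
        refine (hδ' ?_).le
        rw [NNReal.dist_eq, Real.coe_toNNReal _ hs.1.le]
        simpa [abs_of_pos hs.1] using hs.2.trans_lt hn)
    rw [h3, sub_zero, abs_of_pos (hpos n)] at h4
    rw [Real.dist_eq, hg n x]
    have h5 : (1 / ((n : ℝ) + 1))⁻¹ * (∫ s in (0 : ℝ)..1 / ((n : ℝ) + 1),
        ∫ ω, h (X s.toNNReal ω) ∂(P x)) - h x = (1 / ((n : ℝ) + 1))⁻¹ *
        ((∫ s in (0 : ℝ)..1 / ((n : ℝ) + 1), ∫ ω, h (X s.toNNReal ω) ∂(P x))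
          - 1 / ((n : ℝ) + 1) * h x) := by
      rw [mul_sub, inv_mul_cancel_left₀ (hpos n).ne']
    rw [h5, abs_mul, abs_of_pos (inv_pos.2 (hpos n)), inv_mul_lt_iff₀ (hpos n)]
    calc _ ≤ ε / 2 * (1 / ((n : ℝ) + 1)) := h4
      _ < 1 / ((n : ℝ) + 1) * ε := by nlinarith [hpos n]
  have hlim : ∀ w, Tendsto (fun n => onePointExtension (g n) w) atTop
      (𝓝 (onePointExtension h w)) := fun w => by
    induction w using OnePoint.rec with
    | infty => exact tendsto_const_nhds
    | coe x => exact hglim x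
  have h1 : Tendsto (fun n => ∫ w, onePointExtension (g n) w ∂(μ : Measure (OnePoint E))) atTop
      (𝓝 (∫ w, onePointExtension h w ∂(μ : Measure (OnePoint E)))) :=
    tendsto_integral_of_dominated_convergence (fun _ => ‖h.toBCF‖)
      (fun n => (onePointExtension (g n)).continuous.measurable.aestronglyMeasurable)
      (integrable_const _)
      (fun n => Eventually.of_forall (abs_onePointExtension_le (g n) (norm_nonneg _) (hgb n)))
      (Eventually.of_forall hlim)
  simp_rw [hgz] at h1
  exact sub_eq_zero.2 (tendsto_nhds_unique h1 (hlim z))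

end StrongContinuity

/-! ### Maximal inequality: small displacement in short time -/

section MaximalInequality

variable [MetricSpace E] [MeasurableSpace E] [BorelSpace E] [mΩ : MeasurableSpace Ω]
  {ℱ : Filtration ℝ≥0 mΩ} {X : ℝ≥0 → Ω → E} {P : E → Measure Ω}

/-- If the semigroup moves a test function `0 ≤ h ≤ 1` vanishing on `U` by at most `ε` up to time
`t`, then the process started where `h = 1` visits `U` along finitely many times before `t` with
probability at most `2 ε`. -/
lemma measureReal_exists_mem_finset_le (hX : IsStandardMarkovProcess ℱ X P) {t : ℝ≥0} {ε : ℝ}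
    (h : E →ᵇ ℝ) (h_le : ∀ z, h z ≤ 1)
    (hε : ∀ s ≤ t, ∀ z, |∫ ω, h (X s ω) ∂(P z) - h z| ≤ ε)
    {U : Set E} (hU : MeasurableSet U) (hU0 : ∀ z ∈ U, h z = 0) {y : E} (hy : h y = 1)
    (F : Finset ℝ≥0) (hF : ∀ u ∈ F, u ≤ t) :
    (P y).real {ω | ∃ u ∈ F, X u ω ∈ U} ≤ 2 * ε := by
  have := hX.isProbability
  set D := {ω | ∃ u ∈ F, X u ω ∈ U} with hD
  -- `A u` is the event that `u` is the first time in `F` at which `U` is visited. It belongs to `ℱ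
  -- u`, so the Markov property applies at `u`, where `h (X u) = 0`.
  let A : ℝ≥0 → Set Ω := fun u => X u ⁻¹' U ∩ ⋂ v ∈ F.filter (· < u), (X v ⁻¹' U)ᶜ
  have hA : ∀ u, MeasurableSet[ℱ u] (A u) := fun u => by
    refine MeasurableSet.inter (hX.adapted u hU) (Finset.measurableSet_biInter _ fun v hv => ?_)
    exact (ℱ.mono (Finset.mem_filter.1 hv).2.le _ (hX.adapted v hU)).compl
  have hA' : ∀ u, MeasurableSet (A u) := fun u => ℱ.le u _ (hA u)
  have hDA : D = ⋃ u ∈ F, A u := by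
    ext ω
    simp only [hD, A, mem_ofPred_eq, mem_iUnion, mem_inter_iff, mem_preimage, mem_iInter,
      Finset.mem_filter, mem_compl_iff, exists_prop]
    constructor
    · rintro ⟨u, hu, huU⟩
      classical
      obtain ⟨v, hv, hmin⟩ := (F.filter fun u => X u ω ∈ U).exists_min_image id
        ⟨u, Finset.mem_filter.2 ⟨hu, huU⟩⟩
      rw [Finset.mem_filter] at hv
      exact ⟨v, hv.1, hv.2, fun w hw hwU =>
        (hmin w (Finset.mem_filter.2 ⟨hw.1, hwU⟩)).not_gt hw.2⟩
    · rintro ⟨u, hu, huU, -⟩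
      exact ⟨u, hu, huU⟩
  have hdisj : (F : Set ℝ≥0).PairwiseDisjoint A := by
    have key : ∀ u ∈ F, ∀ v, u < v → Disjoint (A u) (A v) := fun u hu v huv => by
      rw [Set.disjoint_left]
      intro ω hω hω'
      exact (mem_iInter₂.1 hω'.2 u (Finset.mem_filter.2 ⟨hu, huv⟩)) hω.1
    intro u hu v hv huv
    rcases lt_or_gt_of_ne huv with h1 | h1
    · exact key u hu v h1
    · exact (key v hv u h1).symm
  have hDm : MeasurableSet D := by
    rw [hDA]
    exact Finset.measurableSet_biUnion _ fun u _ => hA' u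
  have hint := hX.integrable_comp y t h
  have h1 : ∀ u ∈ F, ∫ ω in A u, h (X t ω) ∂(P y) ≤ ε * (P y).real (A u) := fun u hu => by
    have hm := hX.setIntegral_add y (t - u) u (hA u) h
    rw [add_tsub_cancel_of_le (hF u hu)] at hm
    rw [hm]
    refine (Real.le_norm_self _).trans (norm_setIntegral_le_of_norm_le_const (measure_lt_top _ _)
      fun ω hω => ?_)
    have := hε (t - u) tsub_le_self (X u ω)
    rw [hU0 _ hω.1, sub_zero] at this
    exact this
  have h2 : ∫ ω in D, h (X t ω) ∂(P y) ≤ ε * (P y).real D := by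
    rw [hDA, integral_biUnion_finset F (fun u _ => hA' u) hdisj (fun u _ => hint.integrableOn),
      measureReal_biUnion_finset hdisj (fun u _ => hA' u), Finset.mul_sum]
    exact Finset.sum_le_sum h1
  have h3 : ∫ ω in Dᶜ, h (X t ω) ∂(P y) ≤ 1 - (P y).real D := by
    rw [← probReal_compl_eq_one_sub hDm]
    calc ∫ ω in Dᶜ, h (X t ω) ∂(P y) ≤ ∫ ω in Dᶜ, (1 : ℝ) ∂(P y) :=
          integral_mono hint.integrableOn (integrable_const _) fun ω => h_le _
      _ = _ := by simp
  -- With `p` the probability of `D`, `1 - ε ≤ E[h (X t)] ≤ ε * p + (1 - p)`, so `p ≤ ε + ε * p ≤ 2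
  -- * ε`.
  have h4 := hε t le_rfl y
  rw [hy, ← integral_add_compl hDm hint, abs_le] at h4
  have hε0 : 0 ≤ ε := (abs_nonneg _).trans (hε t le_rfl y)
  have h5 : ε * (P y).real D ≤ ε := mul_le_of_le_one_right hε0 measureReal_le_one
  linarith [h4.1]

omit [MeasurableSpace E] [BorelSpace E] mΩ in
lemma exists_denseSeq_mem {X : ℝ≥0 → Ω → E} {ω : Ω}
    (hc : ∀ t : ℝ≥0, ContinuousWithinAt (fun u => X u ω) (Ici t) t)
    {U : Set E} (hU : IsOpen U) {u t : ℝ≥0} (hut : u < t) (hu : X u ω ∈ U) :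
    ∃ i, TopologicalSpace.denseSeq ℝ≥0 i < t ∧ X (TopologicalSpace.denseSeq ℝ≥0 i) ω ∈ U := by
  have h1 : ∀ᶠ v in 𝓝[>] u, X v ω ∈ U :=
    ((hc u).mono Ioi_subset_Ici_self).eventually (hU.mem_nhds hu)
  obtain ⟨b, hb, hsub⟩ := (mem_nhdsGT_iff_exists_Ioo_subset' hut).1 h1
  have hne : (Ioo u (min b t)).Nonempty := nonempty_Ioo.2 (lt_min hb hut)
  obtain ⟨i, hi⟩ := (TopologicalSpace.denseRange_denseSeq ℝ≥0).exists_mem_open isOpen_Ioo hne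
  exact ⟨i, hi.2.trans_le (min_le_right _ _), hsub ⟨hi.1, hi.2.trans_le (min_le_left _ _)⟩⟩

-- By right-continuity a visit before `t` recurs at a dense time before `t`. A visit exactly at `t`
-- need not, so `t` is inserted by hand; the `min` keeps all sampled times within `[0, t]`.
omit [MeasurableSpace E] [BorelSpace E] mΩ in
lemma setOf_exists_le_mem_eq {X : ℝ≥0 → Ω → E}
    (hc : ∀ ω, ∀ t : ℝ≥0, ContinuousWithinAt (fun u => X u ω) (Ici t) t)
    {U : Set E} (hU : IsOpen U) (t : ℝ≥0) :
    {ω | ∃ u ≤ t, X u ω ∈ U} = ⋃ n : ℕ, {ω | ∃ u ∈ insert t ((Finset.range n).image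
      fun i => min (TopologicalSpace.denseSeq ℝ≥0 i) t), X u ω ∈ U} := by
  ext ω
  simp only [mem_ofPred_eq, mem_iUnion]
  constructor
  · rintro ⟨u, hu, huU⟩
    rcases hu.eq_or_lt with rfl | hlt
    · exact ⟨0, u, Finset.mem_insert_self _ _, huU⟩
    · obtain ⟨i, hi, hiU⟩ := exists_denseSeq_mem (hc ω) hU hlt huU
      refine ⟨i + 1, _, Finset.mem_insert_of_mem (Finset.mem_image.2 ⟨i, by simp, ?_⟩), hiU⟩
      exact min_eq_left hi.le
  · rintro ⟨n, u, hu, huU⟩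
    refine ⟨u, ?_, huU⟩
    rcases Finset.mem_insert.1 hu with rfl | hu
    · exact le_rfl
    · obtain ⟨i, -, rfl⟩ := Finset.mem_image.1 hu
      exact min_le_right _ _

lemma measurableSet_exists_le_mem (hX : IsStandardMarkovProcess ℱ X P) {U : Set E}
    (hU : IsOpen U) (t : ℝ≥0) : MeasurableSet {ω | ∃ u ≤ t, X u ω ∈ U} := by
  rw [setOf_exists_le_mem_eq hX.right_continuous hU]
  refine MeasurableSet.iUnion fun n => ?_
  simp_rw [← exists_prop, ofPred_exists]
  exact Finset.measurableSet_biUnion _ fun u _ => hX.measurable u hU.measurableSet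

lemma measureReal_exists_le_mem_le (hX : IsStandardMarkovProcess ℱ X P) {t : ℝ≥0} {ε : ℝ}
    (h : E →ᵇ ℝ) (h_le : ∀ z, h z ≤ 1)
    (hε : ∀ s ≤ t, ∀ z, |∫ ω, h (X s ω) ∂(P z) - h z| ≤ ε)
    {U : Set E} (hU : IsOpen U) (hU0 : ∀ z ∈ U, h z = 0) {y : E} (hy : h y = 1) :
    (P y).real {ω | ∃ u ≤ t, X u ω ∈ U} ≤ 2 * ε := by
  have := hX.isProbability
  have hε0 : 0 ≤ ε := (abs_nonneg _).trans (hε t le_rfl y)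
  refine ENNReal.toReal_le_of_le_ofReal (by positivity) ?_
  rw [setOf_exists_le_mem_eq hX.right_continuous hU, Monotone.measure_iUnion]
  · refine iSup_le fun n => ?_
    rw [← ofReal_measureReal]
    refine ENNReal.ofReal_le_ofReal (measureReal_exists_mem_finset_le hX h h_le hε
      hU.measurableSet hU0 hy _ fun u hu => ?_)
    rcases Finset.mem_insert.1 hu with rfl | hu
    · exact le_rfl
    · obtain ⟨i, -, rfl⟩ := Finset.mem_image.1 hu
      exact min_le_right _ _
  · rintro m n hmn ω ⟨u, hu, huU⟩
    exact ⟨u, Finset.insert_subset_insert _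
      (Finset.image_subset_image (Finset.range_mono hmn)) hu, huU⟩

/-- Locally uniformly in the starting point, the process does not leave balls immediately. -/
lemma eventually_measureReal_exists_dist_gt_le [ProperSpace E]
    (hX : IsStandardMarkovProcess ℱ X P) (hF : IsWeakFeller X P) (x : E) {r ε : ℝ} (hr : 0 < r)
    (hε : 0 < ε) :
    ∀ᶠ t : ℝ≥0 in 𝓝 0, ∀ y ∈ Metric.closedBall x r,
      (P y).real {ω | ∃ u ≤ t, X u ω ∈ {z | 2 * r < dist z x}} ≤ ε := by
  -- A bump equal to `1` on the ball of radius `r` and to `0` outside that of radius `2 * r`;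
  -- properness of `E` puts it in `C₀`.
  let h : C₀(E, ℝ) :=
    { toFun := fun z => max 0 (min 1 (2 - dist z x / r))
      continuous_toFun := by fun_prop
      zero_at_infty' := by
        refine tendsto_const_nhds.congr' ?_
        filter_upwards [(isCompact_closedBall x (2 * r)).compl_mem_cocompact] with z hz
        have hz' : 2 * r < dist z x := by simpa using hz
        have : 2 < dist z x / r := (lt_div_iff₀ hr).2 hz'
        rw [max_eq_left ((min_le_right _ _).trans (by linarith))] }
  have hh : ∀ z, h z = max 0 (min 1 (2 - dist z x / r)) := fun z => rfl
  have h1 := Metric.tendstoUniformly_iff.1 (tendstoUniformly_integral_comp hX hF h) (ε / 2)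
    (half_pos hε)
  obtain ⟨δ, hδ, hδ'⟩ := Metric.eventually_nhds_iff.1 h1
  filter_upwards [Metric.ball_mem_nhds 0 hδ] with t ht y hy
  have hU : IsOpen {z | 2 * r < dist z x} := isOpen_lt continuous_const (by fun_prop)
  refine (measureReal_exists_le_mem_le hX (ε := ε / 2) h.toBCF (fun z => ?_) (fun s hs z => ?_) hU
    (fun z hz => ?_) (y := y) ?_).trans (by linarith)
  · exact max_le zero_le_one (min_le_left _ _)
  · have hs' : dist s 0 < δ := by
      rw [Metric.mem_ball, NNReal.dist_eq] at ht
      rw [NNReal.dist_eq]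
      have : (s : ℝ) ≤ t := hs
      simp only [NNReal.coe_zero, sub_zero, NNReal.abs_eq] at ht ⊢
      linarith
    have := hδ' hs' z
    rw [dist_comm, Real.dist_eq, sub_zero] at this
    exact this.le
  · have : 2 < dist z x / r := (lt_div_iff₀ hr).2 hz
    exact max_eq_left ((min_le_right _ _).trans (by linarith))
  · have h2 : dist y x / r ≤ 1 := (div_le_one hr).2 hy
    change max 0 (min 1 (2 - dist y x / r)) = 1
    rw [min_eq_left (by linarith), max_eq_right zero_le_one]

end MaximalInequality

/-! ### Measurability of the exit time and fast exit near the boundary -/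

section ExitTime

lemma untopA_coe (a : ℝ≥0) : (a : WithTop ℝ≥0).untopA = a := rfl

variable [MetricSpace E] [MeasurableSpace E] [BorelSpace E] [mΩ : MeasurableSpace Ω]
  {ℱ : Filtration ℝ≥0 mΩ} {X : ℝ≥0 → Ω → E} {P : E → Measure Ω}

/-- The hitting time of an open set is a stopping time. -/
lemma isStoppingTime_hittingAfter_isOpen (hX : IsStandardMarkovProcess ℱ X P) {U : Set E}
    (hU : IsOpen U) : IsStoppingTime ℱ (hittingAfter X U 0) := by
  have := hX.filtration_right_continuous
  -- Right-continuity of the filtration reduces the claim to the events with strict inequality,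
  -- which need only countably many times.
  refine isStoppingTime_of_measurableSet_lt_of_isRightContinuous fun t => ?_
  have h1 : {ω | hittingAfter X U 0 ω < t} =
      ⋃ i ∈ {i | TopologicalSpace.denseSeq ℝ≥0 i < t},
        X (TopologicalSpace.denseSeq ℝ≥0 i) ⁻¹' U := by
    ext ω
    simp only [mem_ofPred_eq, hittingAfter_lt_iff, mem_iUnion, mem_preimage, exists_prop]
    constructor
    · rintro ⟨u, hu, huU⟩
      exact exists_denseSeq_mem (hX.right_continuous ω) hU hu.2 huU
    · rintro ⟨i, hi, hiU⟩
      exact ⟨_, ⟨zero_le, hi⟩, hiU⟩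
  rw [h1]
  refine MeasurableSet.biUnion (to_countable _) fun i hi => ?_
  exact ℱ.mono (le_of_lt hi) _ (hX.adapted _ hU.measurableSet)

-- The infimum of the visiting times is approached by them from the right, where the path is
-- continuous.
omit [MeasurableSpace E] [BorelSpace E] mΩ in
lemma mem_closure_of_hittingAfter_ne_top {X : ℝ≥0 → Ω → E} {ω : Ω}
    (hc : ∀ t : ℝ≥0, ContinuousWithinAt (fun u => X u ω) (Ici t) t) {U : Set E}
    (h : hittingAfter X U 0 ω ≠ ⊤) : X (hittingAfter X U 0 ω).untopA ω ∈ closure U := by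
  have hex : ∃ j : ℝ≥0, 0 ≤ j ∧ X j ω ∈ U := by
    rw [ne_eq, hittingAfter_eq_top_iff] at h
    push Not at h
    exact h
  have heq : hittingAfter X U 0 ω = ((sInf {i : ℝ≥0 | 0 ≤ i ∧ X i ω ∈ U} : ℝ≥0) : WithTop ℝ≥0) :=
    if_pos hex
  rw [heq, untopA_coe]
  have hbdd : BddBelow {i : ℝ≥0 | 0 ≤ i ∧ X i ω ∈ U} := OrderBot.bddBelow _
  exact ((hc _).mono fun i hi => csInf_le hbdd hi).mem_closure (csInf_mem_closure hex hbdd)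
    fun i hi => hi.2

/-- The exit time from an open set agrees almost surely with a random variable. -/
lemma exists_measurable_ae_eq_exitTime (hX : IsStandardMarkovProcess ℱ X P) {O : Set E}
    (hO : IsOpen O) :
    ∃ T : Ω → WithTop ℝ≥0, Measurable T ∧ ∀ x, T =ᵐ[P x] exitTime X O := by
  -- Hitting times of the open neighbourhoods `U n` of `Oᶜ` increase to `T`, and
  -- quasi-left-continuity puts `X` at time `T` in the closed set `Oᶜ`, so `T` is the exit time. The
  -- extended distance also covers `Oᶜ = ∅`, where it is infinite and every `U n` is empty.
  let U : ℕ → Set E := fun n => {z | Metric.infEDist z Oᶜ < 1 / ((n : ℝ≥0∞) + 1)}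
  have hU : ∀ n, IsOpen (U n) := fun n =>
    isOpen_lt Metric.continuous_infEDist continuous_const
  have hUanti : Antitone U := fun m n hmn z hz => by
    have hz' : Metric.infEDist z Oᶜ < 1 / ((n : ℝ≥0∞) + 1) := hz
    refine mem_ofPred_eq ▸ hz'.trans_le ?_
    gcongr
  have hOU : ∀ n, Oᶜ ⊆ U n := fun n z hz => by
    simp only [U, mem_ofPred_eq, Metric.infEDist_zero_of_mem hz]
    simp
  let S : ℕ → Ω → WithTop ℝ≥0 := fun n => hittingAfter X (U n) 0
  have hS : ∀ n, IsStoppingTime ℱ (S n) := fun n => isStoppingTime_hittingAfter_isOpen hX (hU n)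
  have hmono : ∀ ω, Monotone fun n => S n ω := fun ω m n hmn =>
    hittingAfter_apply_anti X 0 ω (hUanti hmn)
  let T : Ω → WithTop ℝ≥0 := fun ω => ⨆ n, S n ω
  refine ⟨T, Measurable.iSup fun n => (hS n).measurable', fun x => ?_⟩
  filter_upwards [hX.quasi_left_continuous S T hS hmono (fun ω => isLUB_iSup) x] with ω hω
  have hle : T ω ≤ exitTime X O ω := iSup_le fun n => hittingAfter_apply_anti X 0 ω (hOU n)
  refine le_antisymm hle ?_
  by_cases htop : T ω = ⊤
  · rw [htop]
    exact le_top
  have hSne : ∀ n, S n ω ≠ ⊤ := fun n hn =>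
    htop (top_le_iff.1 (hn ▸ le_iSup (fun n => S n ω) n))
  have hbound : ∀ n, Metric.infEDist (X (S n ω).untopA ω) Oᶜ ≤ 1 / ((n : ℝ≥0∞) + 1) := fun n => by
    have h1 := mem_closure_of_hittingAfter_ne_top (hX.right_continuous ω) (hSne n)
    have h2 : closure (U n) ⊆ {z | Metric.infEDist z Oᶜ ≤ 1 / ((n : ℝ≥0∞) + 1)} :=
      closure_minimal (ofPred_subset_ofPred.2 fun z hz => le_of_lt hz)
        (isClosed_le Metric.continuous_infEDist continuous_const)
    exact h2 h1
  have hlim : Tendsto (fun n : ℕ => 1 / ((n : ℝ≥0∞) + 1)) atTop (𝓝 0) := by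
    have h1 := (tendsto_add_atTop_iff_nat 1).2 ENNReal.tendsto_inv_nat_nhds_zero
    simpa using h1
  have h0 : Metric.infEDist (X (T ω).untopA ω) Oᶜ ≤ 0 :=
    le_of_tendsto_of_tendsto' ((Metric.continuous_infEDist.tendsto _).comp (hω htop)) hlim hbound
  have hmem : X (T ω).untopA ω ∈ Oᶜ :=
    (Metric.mem_iff_infEDist_zero_of_closed hO.isClosed_compl).2 (le_antisymm h0 zero_le)
  calc exitTime X O ω ≤ ((T ω).untopA : WithTop ℝ≥0) := hittingAfter_le_of_mem zero_le hmem
    _ = T ω := by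
      generalize T ω = a at htop
      lift a to ℝ≥0 using htop
      rfl

omit [BorelSpace E] in
lemma exitTime_eq_zero (hX : IsStandardMarkovProcess ℱ X P) {O : Set E} {x : E} (hx : x ∉ O) :
    ∀ᵐ ω ∂(P x), exitTime X O ω = 0 := by
  filter_upwards [hX.start x] with ω hω
  have h1 : X 0 ω ∈ Oᶜ := by rw [hω]; exact hx
  exact le_antisymm (hittingAfter_le_of_mem le_rfl h1) zero_le

omit [BorelSpace E] in
lemma exitTime_pos (hX : IsStandardMarkovProcess ℱ X P) {O : Set E} (hO : IsOpen O) {x : E}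
    (hx : x ∈ O) : ∀ᵐ ω ∂(P x), 0 < exitTime X O ω := by
  filter_upwards [hX.start x] with ω hω
  rw [pos_iff_ne_zero]
  intro h0
  have hne : hittingAfter X Oᶜ 0 ω ≠ ⊤ := fun h => by
    rw [exitTime] at h0
    exact WithTop.top_ne_zero (h.symm.trans h0)
  have h1 := mem_closure_of_hittingAfter_ne_top (hX.right_continuous ω) hne
  have h2 : hittingAfter X Oᶜ 0 ω = ((0 : ℝ≥0) : WithTop ℝ≥0) := h0
  rw [hO.isClosed_compl.closure_eq, h2, untopA_coe, hω] at h1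
  exact h1 hx

/-- Started in `O` near a point outside `O`, the process leaves `O` quickly. -/
lemma tendsto_measureReal_lt_exitTime (hX : IsStandardMarkovProcess ℱ X P) {O : Set E}
    (hO : IsOpen O) (hA1 : StoppedFeller X P O) {x : E} (hx : x ∉ O) {t : ℝ≥0} (ht : 0 < t) :
    Tendsto (fun y => (P y).real {ω | (t : WithTop ℝ≥0) < exitTime X O ω}) (𝓝 x) (𝓝 0) := by
  have := hX.isProbability
  obtain ⟨T, hT, hTe⟩ := exists_measurable_ae_eq_exitTime hX hO
  -- This identifies the integral in `StoppedFeller` with the survival probability.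
  have hnull : ∀ y, NullMeasurableSet {ω | (t : WithTop ℝ≥0) < exitTime X O ω} (P y) := fun y => by
    refine (measurableSet_lt measurable_const hT).nullMeasurableSet.congr (s :=
      {ω | (t : WithTop ℝ≥0) < T ω}) ?_
    filter_upwards [hTe y] with ω hω
    exact propext (by change _ < T ω ↔ _ < _; rw [hω])
  have h1 : ∀ y, (P y).real {ω | (t : WithTop ℝ≥0) < exitTime X O ω} =
      ∫ ω, {ω | (t : WithTop ℝ≥0) < exitTime X O ω}.indicator
        (fun ω => BoundedContinuousFunction.const E (1 : ℝ) (X t ω)) ω ∂(P y) := fun y => by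
    rw [integral_indicator₀ (hnull y)]
    simp
  simp_rw [h1]
  have h2 := (hA1 t ht (BoundedContinuousFunction.const E (1 : ℝ))).tendsto x
  rw [← h1 x] at h2
  have h3 : (P x).real {ω | (t : WithTop ℝ≥0) < exitTime X O ω} = 0 := by
    rw [measureReal_eq_zero_iff]
    refine measure_eq_zero_iff_ae_notMem.2 ?_
    filter_upwards [exitTime_eq_zero hX hx] with ω h0 hω
    have hlt : (t : WithTop ℝ≥0) < exitTime X O ω := hω
    rw [h0] at hlt
    exact not_lt_zero hlt
  rwa [h3] at h2

end ExitTime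

/-! ### Payoff estimates and the value function near the boundary -/

section Payoff

variable [MetricSpace E] {X : ℝ≥0 → Ω → E} {α : ℝ}

lemma abs_exp_neg_mul_le (hα : 0 < α) (φ : (ℝ≥0 × E) →ᵇ ℝ) (p : ℝ≥0 × E) {u : ℝ} (hu : 0 ≤ u) :
    |Real.exp (-(α * u)) * φ p| ≤ ‖φ‖ := by
  rw [abs_mul, Real.abs_exp]
  have h1 : Real.exp (-(α * u)) ≤ 1 := Real.exp_le_one_iff.2 (by nlinarith)
  calc Real.exp (-(α * u)) * |φ p| ≤ 1 * ‖φ‖ :=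
        mul_le_mul h1 (φ.norm_coe_le_norm p) (abs_nonneg _) zero_le_one
    _ = ‖φ‖ := one_mul _

lemma abs_discountedPayoff_le (hα : 0 < α) (φ : (ℝ≥0 × E) →ᵇ ℝ) (s : ℝ≥0) (ω : Ω)
    (σ : WithTop ℝ≥0) : |discountedPayoff X α φ s ω σ| ≤ ‖φ‖ := by
  cases σ with
  | top => simp [discountedPayoff]
  | coe u => exact abs_exp_neg_mul_le hα φ _ u.coe_nonneg

lemma measurableSet_runningTimes (σ : WithTop ℝ≥0) :
    MeasurableSet {u : ℝ | 0 ≤ u ∧ (u.toNNReal : WithTop ℝ≥0) < σ} :=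
  (measurableSet_le measurable_const measurable_id).inter
    (measurableSet_lt measurable_real_toNNReal.withTop_coe measurable_const)

lemma abs_runningPayoff_le (hα : 0 < α) (f : (ℝ≥0 × E) →ᵇ ℝ) (s : ℝ≥0) (ω : Ω)
    (σ : WithTop ℝ≥0) : |runningPayoff X α f s ω σ| ≤ ‖f‖ / α := by
  have hint : IntegrableOn (fun u : ℝ => ‖f‖ * Real.exp (-α * u)) (Ici 0) := by
    rw [integrableOn_Ici_iff_integrableOn_Ioi]
    exact (exp_neg_integrableOn_Ioi 0 hα).const_mul _
  have hsub : {u : ℝ | 0 ≤ u ∧ (u.toNNReal : WithTop ℝ≥0) < σ} ⊆ Ici 0 := fun u hu => hu.1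
  calc |runningPayoff X α f s ω σ|
      ≤ ∫ u in {u : ℝ | 0 ≤ u ∧ (u.toNNReal : WithTop ℝ≥0) < σ}, ‖f‖ * Real.exp (-α * u) := by
        rw [← Real.norm_eq_abs, runningPayoff]
        refine norm_integral_le_of_norm_le (hint.mono_set hsub) (Eventually.of_forall fun u => ?_)
        rw [norm_mul, Real.norm_eq_abs, Real.abs_exp, mul_comm, neg_mul]
        gcongr
        exact f.norm_coe_le_norm _
    _ ≤ ∫ u in Ici 0, ‖f‖ * Real.exp (-α * u) :=
        setIntegral_mono_set hint (Eventually.of_forall fun u => by positivity)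
          hsub.eventuallyLE
    _ = ‖f‖ / α := by
        rw [integral_Ici_eq_integral_Ioi, integral_const_mul, integral_exp_mul_Ioi (by linarith)]
        simp [div_eq_mul_inv]

lemma abs_runningPayoff_le_mul (hα : 0 < α) (f : (ℝ≥0 × E) →ᵇ ℝ) (s : ℝ≥0) (ω : Ω)
    {σ : WithTop ℝ≥0} {t : ℝ≥0} (hσ : σ ≤ t) : |runningPayoff X α f s ω σ| ≤ ‖f‖ * t := by
  have hsub : {u : ℝ | 0 ≤ u ∧ (u.toNNReal : WithTop ℝ≥0) < σ} ⊆ Icc 0 (t : ℝ) := fun u hu =>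
    ⟨hu.1, Real.toNNReal_le_iff_le_coe.1 (WithTop.coe_lt_coe.1 (hu.2.trans_le hσ)).le⟩
  have hfin : volume (Icc 0 (t : ℝ)) < ⊤ := by simp
  rw [← Real.norm_eq_abs, runningPayoff]
  refine (norm_setIntegral_le_of_norm_le_const (C := ‖f‖) ((measure_mono hsub).trans_lt hfin)
    fun u hu => (Real.norm_eq_abs _).trans_le (abs_exp_neg_mul_le hα f _ hu.1)).trans ?_
  gcongr
  calc volume.real {u : ℝ | 0 ≤ u ∧ (u.toNNReal : WithTop ℝ≥0) < σ}
      ≤ volume.real (Icc 0 (t : ℝ)) := measureReal_mono hsub hfin.ne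
    _ = t := by simp

/-- Since `0 ≤ 1 - exp (-(α * u)) ≤ α * t`, discounting moves `G p` by at most `‖G‖ * (α * t)`,
whatever its sign. -/
lemma exp_neg_mul_mul_le (hα : 0 < α) (G : (ℝ≥0 × E) →ᵇ ℝ) (p : ℝ≥0 × E) {u t : ℝ≥0}
    (hu : u ≤ t) : Real.exp (-(α * u)) * G p ≤ G p + ‖G‖ * (α * t) := by
  have h1 : 1 - α * u ≤ Real.exp (-(α * u)) := by linarith [Real.add_one_le_exp (-(α * u))]
  have h2 : Real.exp (-(α * u)) ≤ 1 :=
    Real.exp_le_one_iff.2 (by have := u.coe_nonneg; nlinarith)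
  have h3 : α * (u : ℝ) ≤ α * t := mul_le_mul_of_nonneg_left hu hα.le
  have h4 := (abs_le.1 (G.norm_coe_le_norm p)).1
  nlinarith [norm_nonneg G]

open Classical in
/-- The total payoff along a path stopped at `τ` or upon exit at time `T`. -/
noncomputable def payoff (X : ℝ≥0 → Ω → E) (α : ℝ) (f G H : ℝ≥0 × E → ℝ) (s : ℝ≥0) (ω : Ω)
    (τ T : WithTop ℝ≥0) : ℝ :=
  runningPayoff X α f s ω (min τ T) +
    if τ < T then discountedPayoff X α G s ω τ else discountedPayoff X α H s ω T

lemma abs_payoff_le (hα : 0 < α) (f G H : (ℝ≥0 × E) →ᵇ ℝ) (s : ℝ≥0) (ω : Ω)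
    (τ T : WithTop ℝ≥0) : |payoff X α f G H s ω τ T| ≤ ‖f‖ / α + (‖G‖ + ‖H‖) := by
  refine (abs_add_le _ _).trans (add_le_add (abs_runningPayoff_le hα f s ω _) ?_)
  split_ifs
  · exact (abs_discountedPayoff_le hα G s ω τ).trans (le_add_of_nonneg_right (norm_nonneg _))
  · exact (abs_discountedPayoff_le hα H s ω T).trans (le_add_of_nonneg_left (norm_nonneg _))

/-- The payoff along a path which exits by time `t` and stays where `G` is close to `c`. -/
lemma payoff_le (hα : 0 < α) (f G H : (ℝ≥0 × E) →ᵇ ℝ) (hGH : ∀ s x, H (s, x) ≤ G (s, x))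
    {s t : ℝ≥0} {ω : Ω} {τ T : WithTop ℝ≥0} (hT : T ≤ t) {c : ℝ}
    (hc : ∀ u ≤ t, G (s + u, X u ω) ≤ c) :
    payoff X α f G H s ω τ T ≤ c + ‖f‖ * t + ‖G‖ * (α * t) := by
  have h1 := (le_abs_self _).trans
    (abs_runningPayoff_le_mul (X := X) hα f s ω ((min_le_right τ T).trans hT))
  have hdisc : ∀ u ≤ t, Real.exp (-(α * u)) * G (s + u, X u ω) ≤ c + ‖G‖ * (α * t) := fun u hu =>
    (exp_neg_mul_mul_le hα G _ hu).trans (by linarith [hc u hu])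
  unfold payoff
  split_ifs with h
  · have hτ : τ ≤ t := h.le.trans hT
    lift τ to ℝ≥0 using ne_top_of_lt h
    have := hdisc τ (WithTop.coe_le_coe.1 hτ)
    simp only [discountedPayoff]
    linarith
  · lift T to ℝ≥0 using (hT.trans_lt (WithTop.coe_lt_top t)).ne
    have h2 := hdisc T (WithTop.coe_le_coe.1 hT)
    -- The hypothesis `H ≤ G` enters here: being paid `H` on exit is no better than being paid `G`.
    have h3 : Real.exp (-(α * T)) * H (s + T, X T ω) ≤ Real.exp (-(α * T)) * G (s + T, X T ω) :=
      mul_le_mul_of_nonneg_left (hGH _ _) (Real.exp_nonneg _)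
    simp only [discountedPayoff]
    linarith

omit [MetricSpace E] in
lemma functional_eq_integral_payoff [MeasurableSpace Ω] (P : E → Measure Ω) (O : Set E)
    (f G H : ℝ≥0 × E → ℝ) (s : ℝ≥0) (x : E) (τ : Ω → WithTop ℝ≥0) :
    functional X P O α f G H s x τ =
      ∫ ω, payoff X α f G H s ω (τ ω) (exitTime X O ω) ∂(P x) := rfl

variable [MeasurableSpace E] [BorelSpace E] [ProperSpace E] [mΩ : MeasurableSpace Ω]
  {ℱ : Filtration ℝ≥0 mΩ} {P : E → Measure Ω}

lemma measurable_discountedPayoff (hX : IsStandardMarkovProcess ℱ X P) (φ : (ℝ≥0 × E) →ᵇ ℝ)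
    (s : ℝ≥0) {τ : Ω → WithTop ℝ≥0} (hτ : Measurable τ) :
    Measurable fun ω => discountedPayoff X α φ s ω (τ ω) := by
  classical
  have heq : (fun ω => discountedPayoff X α φ s ω (τ ω)) = fun ω => if τ ω = ⊤ then 0 else
      Real.exp (-(α * (τ ω).untopA)) * φ (s + (τ ω).untopA, X (τ ω).untopA ω) := by
    funext ω
    generalize τ ω = σ
    cases σ with
    | top => simp [discountedPayoff]
    | coe u =>
      rw [if_neg WithTop.coe_ne_top]
      rfl
  rw [heq]
  refine Measurable.ite (hτ (measurableSet_singleton _)) measurable_const ?_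
  have h1 : Measurable fun ω => (τ ω).untopA := hτ.untopA
  have h2 : Measurable fun ω => X (τ ω).untopA ω :=
    hX.measurable_uncurry.comp (h1.prodMk measurable_id)
  exact (Real.measurable_exp.comp (measurable_const.mul h1.coe_nnreal_real).neg).mul
    (φ.continuous.measurable.comp ((measurable_const.add h1).prodMk h2))

lemma measurable_runningPayoff (hX : IsStandardMarkovProcess ℱ X P) (f : (ℝ≥0 × E) →ᵇ ℝ)
    (s : ℝ≥0) {σ : Ω → WithTop ℝ≥0} (hσ : Measurable σ) :
    Measurable fun ω => runningPayoff X α f s ω (σ ω) := by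
  let S : Set (Ω × ℝ) := {p | 0 ≤ p.2 ∧ (p.2.toNNReal : WithTop ℝ≥0) < σ p.1}
  have hS : MeasurableSet S :=
    (measurableSet_le measurable_const measurable_snd).inter
      (measurableSet_lt (measurable_real_toNNReal.comp measurable_snd).withTop_coe
        (hσ.comp measurable_fst))
  let F : Ω × ℝ → ℝ := S.indicator fun p =>
    Real.exp (-(α * p.2)) * f (s + p.2.toNNReal, X p.2.toNNReal p.1)
  have hF : Measurable F := by
    refine Measurable.indicator ?_ hS
    have h1 : Measurable fun p : Ω × ℝ => p.2.toNNReal :=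
      measurable_real_toNNReal.comp measurable_snd
    have h2 : Measurable fun p : Ω × ℝ => X p.2.toNNReal p.1 :=
      hX.measurable_uncurry.comp (h1.prodMk measurable_fst)
    exact (Real.measurable_exp.comp (measurable_const.mul measurable_snd).neg).mul
      (f.continuous.measurable.comp ((measurable_const.add h1).prodMk h2))
  have heq : (fun ω => runningPayoff X α f s ω (σ ω)) = fun ω => ∫ u, F (ω, u) := by
    funext ω
    rw [runningPayoff, ← integral_indicator (measurableSet_runningTimes _)]
    rfl
  rw [heq]
  exact (hF.stronglyMeasurable.integral_prod_right' (ν := volume)).measurable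

lemma measurable_payoff (hX : IsStandardMarkovProcess ℱ X P) (f G H : (ℝ≥0 × E) →ᵇ ℝ)
    (s : ℝ≥0) {τ T : Ω → WithTop ℝ≥0} (hτ : Measurable τ) (hT : Measurable T) :
    Measurable fun ω => payoff X α f G H s ω (τ ω) (T ω) :=
  (measurable_runningPayoff hX f s (hτ.min hT)).add
    (Measurable.ite (measurableSet_lt hτ hT) (measurable_discountedPayoff hX G s hτ)
      (measurable_discountedPayoff hX H s hT))

lemma integrable_payoff (hX : IsStandardMarkovProcess ℱ X P) {O : Set E} (hO : IsOpen O)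
    (hα : 0 < α) (f G H : (ℝ≥0 × E) →ᵇ ℝ) (s : ℝ≥0) (x : E) {τ : Ω → WithTop ℝ≥0}
    (hτ : Measurable τ) :
    Integrable (fun ω => payoff X α f G H s ω (τ ω) (exitTime X O ω)) (P x) := by
  have := hX.isProbability
  obtain ⟨T, hT, hTe⟩ := exists_measurable_ae_eq_exitTime hX hO
  refine Integrable.of_bound ?_ (‖f‖ / α + (‖G‖ + ‖H‖))
    (Eventually.of_forall fun ω => abs_payoff_le hα f G H s ω _ _)
  exact (measurable_payoff (α := α) hX f G H s hτ hT).aestronglyMeasurable.congr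
    ((hTe x).mono fun ω hω => by simp only [hω])

omit [BorelSpace E] [ProperSpace E] in
lemma abs_functional_le (hX : IsStandardMarkovProcess ℱ X P) (O : Set E)
    (hα : 0 < α) (f G H : (ℝ≥0 × E) →ᵇ ℝ) (s : ℝ≥0) (x : E) (τ : Ω → WithTop ℝ≥0) :
    |functional X P O α f G H s x τ| ≤ ‖f‖ / α + (‖G‖ + ‖H‖) := by
  have := hX.isProbability
  rw [functional_eq_integral_payoff]
  simpa using norm_integral_le_of_norm_le_const (μ := P x)
    (Eventually.of_forall fun ω => (Real.norm_eq_abs _).trans_le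
      (abs_payoff_le (X := X) hα f G H s ω (τ ω) (exitTime X O ω)))

omit [BorelSpace E] [ProperSpace E] in
lemma functional_zero (hX : IsStandardMarkovProcess ℱ X P) {O : Set E} (hO : IsOpen O)
    (f G H : (ℝ≥0 × E) →ᵇ ℝ) (s : ℝ≥0) {y : E} (hy : y ∈ O) :
    functional X P O α f G H s y (fun _ => ((0 : ℝ≥0) : WithTop ℝ≥0)) = G (s, y) := by
  have := hX.isProbability
  rw [functional_eq_integral_payoff]
  have h1 : (fun ω => payoff X α f G H s ω ((0 : ℝ≥0) : WithTop ℝ≥0) (exitTime X O ω)) =ᵐ[P y]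
      fun _ => G (s, y) := by
    filter_upwards [exitTime_pos hX hO hy, hX.start y] with ω hpos hstart
    have hpos' : ((0 : ℝ≥0) : WithTop ℝ≥0) < exitTime X O ω := hpos
    have hempty : {u : ℝ | 0 ≤ u ∧ (u.toNNReal : WithTop ℝ≥0) < ((0 : ℝ≥0) : WithTop ℝ≥0)} = ∅ :=
      eq_empty_of_forall_notMem fun u hu => not_lt_zero (α := ℝ≥0) (WithTop.coe_lt_coe.1 hu.2)
    rw [payoff, if_pos hpos', min_eq_left hpos'.le, runningPayoff, hempty]
    simp [discountedPayoff, hstart]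
  rw [integral_congr_ae h1]
  simp

omit [BorelSpace E] [ProperSpace E] in
lemma le_valueFunction (hX : IsStandardMarkovProcess ℱ X P) {O : Set E} (hO : IsOpen O)
    (hα : 0 < α) (f G H : (ℝ≥0 × E) →ᵇ ℝ) (s : ℝ≥0) {y : E} (hy : y ∈ O) :
    G (s, y) ≤ valueFunction ℱ X P O α f G H s y := by
  rw [← functional_zero (α := α) hX hO f G H s hy]
  refine le_ciSup (f := fun τ : {τ : Ω → WithTop ℝ≥0 // IsStoppingTime ℱ τ} =>
    functional X P O α f G H s y τ.1) ?_ ⟨_, isStoppingTime_const ℱ (0 : ℝ≥0)⟩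
  -- A real supremum dominates its members only if the family is bounded above.
  refine ⟨‖f‖ / α + (‖G‖ + ‖H‖), ?_⟩
  rintro _ ⟨τ, rfl⟩
  exact (le_abs_self _).trans (abs_functional_le hX O hα f G H s y τ.1)

/-- Off two bad events, a visit to `U` by time `t` and survival in `O` past `t`, the pathwise bound
`payoff_le` applies. On them the crude bound on the payoff is used; the extra `‖G‖` in the constant
compensates for a main term that may be as low as `-‖G‖`. -/
lemma valueFunction_le (hX : IsStandardMarkovProcess ℱ X P) {O : Set E} (hO : IsOpen O)
    (hα : 0 < α) (f G H : (ℝ≥0 × E) →ᵇ ℝ) (hGH : ∀ s x, H (s, x) ≤ G (s, x)) (s t : ℝ≥0) (y : E)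
    {U : Set E} (hU : IsOpen U) {c : ℝ} (hcG : -‖G‖ ≤ c)
    (hc : ∀ u ≤ t, ∀ z ∉ U, G (s + u, z) ≤ c) :
    valueFunction ℱ X P O α f G H s y ≤ c + ‖f‖ * t + ‖G‖ * (α * t) +
      (‖f‖ / α + (‖G‖ + ‖H‖) + ‖G‖) * ((P y).real {ω | ∃ u ≤ t, X u ω ∈ U} +
        (P y).real {ω | (t : WithTop ℝ≥0) < exitTime X O ω}) := by
  have := hX.isProbability
  have : Nonempty {τ : Ω → WithTop ℝ≥0 // IsStoppingTime ℱ τ} :=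
    ⟨⟨_, isStoppingTime_const ℱ (0 : ℝ≥0)⟩⟩
  refine ciSup_le fun τ => ?_
  obtain ⟨τ, hτ⟩ := τ
  rw [functional_eq_integral_payoff]
  obtain ⟨T, hT, hTe⟩ := exists_measurable_ae_eq_exitTime hX hO
  set N := ‖f‖ / α + (‖G‖ + ‖H‖) + ‖G‖ with hN
  set b := c + ‖f‖ * t + ‖G‖ * (α * t) with hb
  set A := {ω | ∃ u ≤ t, X u ω ∈ U} with hA
  let B := {ω | (t : WithTop ℝ≥0) < T ω}
  have hAm : MeasurableSet A := measurableSet_exists_le_mem hX hU t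
  have hBm : MeasurableSet B := measurableSet_lt measurable_const hT
  have hBe : (P y).real B = (P y).real {ω | (t : WithTop ℝ≥0) < exitTime X O ω} := by
    refine measureReal_congr ?_
    filter_upwards [hTe y] with ω hω
    exact propext (by change _ < T ω ↔ _ < _; rw [hω])
  have hNnn : 0 ≤ N := by positivity
  have hbG : -‖G‖ ≤ b := by
    have : 0 ≤ ‖f‖ * t + ‖G‖ * (α * t) := by positivity
    linarith
  have hle : (fun ω => payoff X α f G H s ω (τ ω) (exitTime X O ω)) ≤ᵐ[P y]
      fun ω => b + (A.indicator (fun _ => N) ω + B.indicator (fun _ => N) ω) := by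
    filter_upwards [hTe y] with ω hω
    have hpay := (le_abs_self _).trans
      (abs_payoff_le (X := X) hα f G H s ω (τ ω) (exitTime X O ω))
    have hAnn : 0 ≤ A.indicator (fun _ => N) ω := indicator_nonneg (fun _ _ => hNnn) ω
    have hBnn : 0 ≤ B.indicator (fun _ => N) ω := indicator_nonneg (fun _ _ => hNnn) ω
    by_cases hωA : ω ∈ A
    · rw [indicator_of_mem hωA]
      linarith
    by_cases hωB : ω ∈ B
    · rw [indicator_of_mem hωB]
      linarith
    have hexit : exitTime X O ω ≤ t := hω ▸ not_lt.1 hωB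
    have := payoff_le (X := X) (τ := τ ω) (s := s) (c := c) hα f G H hGH hexit fun u hu =>
      hc u hu _ fun hz => hωA ⟨u, hu, hz⟩
    linarith
  have hAi : Integrable (A.indicator fun _ => N) (P y) := (integrable_const N).indicator hAm
  have hBi : Integrable (B.indicator fun _ => N) (P y) := (integrable_const N).indicator hBm
  have hABi : Integrable (fun ω => A.indicator (fun _ => N) ω + B.indicator (fun _ => N) ω)
      (P y) := hAi.add hBi
  calc ∫ ω, payoff X α f G H s ω (τ ω) (exitTime X O ω) ∂(P y)
      ≤ ∫ ω, (b + (A.indicator (fun _ => N) ω + B.indicator (fun _ => N) ω)) ∂(P y) :=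
        integral_mono_ae (integrable_payoff hX hO hα f G H s y hτ.measurable')
          ((integrable_const b).add hABi) hle
    _ = b + N * ((P y).real A + (P y).real B) := by
        rw [integral_add (integrable_const b) hABi, integral_add hAi hBi,
          integral_indicator_const _ hAm, integral_indicator_const _ hBm]
        simp
        ring
    _ = _ := by rw [hBe]

/-- The value function is jointly continuous at the boundary of `O`, with boundary value `G`. -/
lemma tendsto_valueFunction (hX : IsStandardMarkovProcess ℱ X P) (hF : IsWeakFeller X P)
    {O : Set E} (hO : IsOpen O) (hA1 : StoppedFeller X P O) (hα : 0 < α)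
    (f G H : (ℝ≥0 × E) →ᵇ ℝ) (hGH : ∀ s x, H (s, x) ≤ G (s, x)) (s₀ : ℝ≥0) {x₀ : E}
    (hx₀ : x₀ ∉ O) :
    Tendsto (fun p : ℝ≥0 × E => valueFunction ℱ X P O α f G H p.1 p.2) (𝓝 s₀ ×ˢ 𝓝[O] x₀)
      (𝓝 (G (s₀, x₀))) := by
  rw [Metric.tendsto_nhds]
  intro ε hε
  set N := ‖f‖ / α + (‖G‖ + ‖H‖) + ‖G‖ with hN
  have hNnn : 0 ≤ N := by positivity
  obtain ⟨ρ, hρ, hG⟩ := Metric.continuousAt_iff.1 (G.continuous.continuousAt (x := (s₀, x₀)))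
    (ε / 8) (by positivity)
  -- `N + 1` replaces `N`, which may be zero.
  have hε1 : 0 < ε / (8 * (N + 1)) := by positivity
  have hNε : N * (ε / (8 * (N + 1))) ≤ ε / 8 := by
    rw [mul_div_assoc', div_le_div_iff₀ (by positivity) (by norm_num)]
    nlinarith
  have hsmall : ∀ {C δ : ℝ}, 0 < δ → ∀ᶠ t : ℝ≥0 in 𝓝 0, C * t < δ := fun {C δ} hδ => by
    have h1 : Tendsto (fun t : ℝ≥0 => C * (t : ℝ)) (𝓝 0) (𝓝 0) := by
      have := (NNReal.continuous_coe.tendsto 0).const_mul C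
      simpa using this
    exact h1.eventually_lt_const hδ
  -- The time `t` is fixed before `y` approaches `x₀`: the displacement estimate is uniform over the
  -- ball, whereas the exit estimate is a limit in `y` for a given `t`. Staying within `ρ / 2` of
  -- `x₀` keeps the path where `G` varies by less than `ε / 8`; in total the upper bound exceeds `G
  -- (s₀, x₀)` by at most `5 * ε / 8`.
  have hev : ∀ᶠ t : ℝ≥0 in 𝓝[>] 0, (∀ y ∈ Metric.closedBall x₀ (ρ / 4),
      (P y).real {ω | ∃ u ≤ t, X u ω ∈ {z | 2 * (ρ / 4) < dist z x₀}} ≤ ε / (8 * (N + 1))) ∧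
      1 * (t : ℝ) < ρ / 2 ∧ ‖f‖ * t < ε / 8 ∧ (‖G‖ * α) * t < ε / 8 ∧ 0 < t :=
    (((eventually_measureReal_exists_dist_gt_le hX hF x₀ (by positivity) hε1).and
      ((hsmall (half_pos hρ)).and ((hsmall (by positivity)).and
        (hsmall (by positivity))))).filter_mono nhdsWithin_le_nhds).and self_mem_nhdsWithin
      |>.mono fun t ht => ⟨ht.1.1, ht.1.2.1, ht.1.2.2.1, ht.1.2.2.2, ht.2⟩
  obtain ⟨t, hball, htρ, htf, htG, htpos⟩ := hev.exists
  have hU : IsOpen {z | 2 * (ρ / 4) < dist z x₀} := isOpen_lt continuous_const (by fun_prop)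
  have hexit := (tendsto_measureReal_lt_exitTime hX hO hA1 hx₀ htpos).eventually_lt_const hε1
  have hy : ∀ᶠ y in 𝓝[O] x₀, y ∈ O ∧ dist y x₀ < ρ / 4 ∧
      (P y).real {ω | (t : WithTop ℝ≥0) < exitTime X O ω} < ε / (8 * (N + 1)) :=
    Filter.Eventually.and self_mem_nhdsWithin ((Filter.Eventually.and
      (Metric.ball_mem_nhds x₀ (show 0 < ρ / 4 by positivity)) hexit).filter_mono
        nhdsWithin_le_nhds)
  have hs : ∀ᶠ s in 𝓝 s₀, dist s s₀ < ρ / 2 := Metric.ball_mem_nhds s₀ (half_pos hρ)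
  filter_upwards [hs.prod_mk hy] with ⟨s, y⟩ ⟨hs, hyO, hyd, hyexit⟩
  simp only at hs hyO hyd hyexit
  have hlow := le_valueFunction (P := P) hX hO hα f G H s hyO
  have hG1 : |G (s, y) - G (s₀, x₀)| < ε / 8 := by
    refine hG ?_
    rw [Prod.dist_eq]
    exact max_lt (hs.trans (by linarith)) (hyd.trans (by linarith))
  have hup := valueFunction_le (ℱ := ℱ) (P := P) hX hO hα f G H hGH s t y hU
    (c := G (s₀, x₀) + ε / 8) (by linarith [(abs_le.1 (G.norm_coe_le_norm (s₀, x₀))).1])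
    fun u hu z hz => by
      have hz' : dist z x₀ ≤ 2 * (ρ / 4) := not_lt.1 hz
      have hsu : dist (s + u) s₀ < ρ := by
        have hu' : (u : ℝ) ≤ t := hu
        have h1 : dist (s + u) s = u := by
          rw [NNReal.dist_eq]
          simp
        linarith [dist_triangle (s + u) s s₀]
      have : |G (s + u, z) - G (s₀, x₀)| < ε / 8 := by
        refine hG ?_
        rw [Prod.dist_eq]
        exact max_lt hsu (by change dist z x₀ < ρ; linarith)
      linarith [(abs_lt.1 this).2]
  have hsum : N * ((P y).real {ω | ∃ u ≤ t, X u ω ∈ {z | 2 * (ρ / 4) < dist z x₀}} +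
      (P y).real {ω | (t : WithTop ℝ≥0) < exitTime X O ω}) ≤ 2 * (ε / 8) := by
    have := hball y hyd.le
    calc _ ≤ N * (ε / (8 * (N + 1)) + ε / (8 * (N + 1))) := by gcongr
      _ ≤ _ := by linarith
  rw [Real.dist_eq, abs_lt]
  constructor
  · linarith [(abs_lt.1 hG1).1]
  · linarith

end Payoff

end BoundaryStopping

theorem mainTheorem7 {E Ω : Type*} [MetricSpace E] [ProperSpace E] [MeasurableSpace E]
    [BorelSpace E] [mΩ : MeasurableSpace Ω] (ℱ : Filtration ℝ≥0 mΩ) (X : ℝ≥0 → Ω → E)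
    (P : E → Measure Ω) (hX : BoundaryStopping.IsStandardMarkovProcess ℱ X P)
    (hFeller : BoundaryStopping.IsWeakFeller X P) (O : Set E) (hO : IsOpen O)
    (hA1 : BoundaryStopping.StoppedFeller X P O) (α : ℝ) (hα : 0 < α)
    (f G H : (ℝ≥0 × E) →ᵇ ℝ) (hGH : ∀ s x, H (s, x) ≤ G (s, x)) :
    (∀ x ∈ frontier O, ∀ s : ℝ≥0,
      Tendsto (fun y => BoundaryStopping.valueFunction ℱ X P O α f G H s y)
        (𝓝[O] x) (𝓝 (G (s, x)))) ∧
    (∀ (S : Set ℝ≥0) (K : Set E), IsCompact S → IsCompact K → ∀ ε > 0, ∃ δ > 0,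
      ∀ s ∈ S, ∀ x ∈ K ∩ frontier O, ∀ y ∈ O, dist y x < δ →
        |BoundaryStopping.valueFunction ℱ X P O α f G H s y - G (s, x)| < ε) := by
  have hmem : ∀ x ∈ frontier O, x ∉ O := fun x hx hxO => by
    rw [hO.frontier_eq] at hx
    exact hx.2 hxO
  have key := fun s x (hx : x ∈ frontier O) => BoundaryStopping.tendsto_valueFunction hX hFeller
    hO hA1 hα f G H hGH s (hmem x hx)
  refine ⟨fun x hx s => (key s x hx).comp (tendsto_const_nhds.prodMk tendsto_id),
    fun S K hS hK ε hε => ?_⟩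
  have hcomp : IsCompact (S ×ˢ (K ∩ frontier O)) := hS.prod (hK.inter_right isClosed_frontier)
  -- The radius `δ` is treated as a real parameter tending to `0`, so that compactness of the set of
  -- pairs `(s, x)` yields one `δ` for all; a positive one is selected afterwards.
  have hev := hcomp.eventually_forall_of_forall_eventually (x₀ := (0 : ℝ))
    (P := fun δ p => ∀ y ∈ O, dist y p.2 < δ →
      |BoundaryStopping.valueFunction ℱ X P O α f G H p.1 y - G p| < ε) ?_
  · obtain ⟨δ, hδ, hδpos⟩ := ((hev.filter_mono nhdsWithin_le_nhds).and
      (self_mem_nhdsWithin (s := Ioi (0 : ℝ)))).exists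
    exact ⟨δ, hδpos, fun s hs x hx y hy hyx => hδ (s, x) ⟨hs, hx⟩ y hy hyx⟩
  · rintro ⟨s₀, x₀⟩ ⟨-, -, hx₀⟩
    have h1 := (Metric.tendsto_nhds.1 (key s₀ x₀ hx₀) (ε / 2) (half_pos hε))
    obtain ⟨p, hp, q, hq, hpq⟩ := eventually_prod_iff.1 h1
    obtain ⟨ρ, hρ, hρq⟩ := Metric.eventually_nhds_iff.1 (eventually_nhdsWithin_iff.1 hq)
    have h2 : ∀ᶠ z : ℝ × ℝ≥0 × E in 𝓝 (0, s₀, x₀), p z.2.1 :=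
      (continuous_fst.comp continuous_snd).continuousAt.eventually hp
    -- By the triangle inequality, `dist y x < δ` then puts `y` within `ρ` of `x₀`.
    have h3 : ∀ᶠ z : ℝ × ℝ≥0 × E in 𝓝 (0, s₀, x₀), z.1 + dist z.2.2 x₀ < ρ := by
      have hc : Continuous fun z : ℝ × ℝ≥0 × E => z.1 + dist z.2.2 x₀ := by fun_prop
      exact hc.continuousAt.eventually_lt continuousAt_const (by simpa using hρ)
    have h4 : ∀ᶠ z : ℝ × ℝ≥0 × E in 𝓝 (0, s₀, x₀), dist (G z.2) (G (s₀, x₀)) < ε / 2 :=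
      (G.continuous.comp continuous_snd).continuousAt.eventually
        (Metric.ball_mem_nhds _ (half_pos hε))
    filter_upwards [h2, h3, h4] with ⟨δ, s, x⟩ hp' hδ hG y hy hyx
    have h5 : dist (BoundaryStopping.valueFunction ℱ X P O α f G H s y) (G (s₀, x₀)) < ε / 2 :=
      hpq hp' (hρq (by linarith [dist_triangle y x x₀]) hy)
    rw [← Real.dist_eq]
    linarith [dist_triangle_right (BoundaryStopping.valueFunction ℱ X P O α f G H s y)
      (G (s, x)) (G (s₀, x₀))]
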